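/- There is an integer $N$ such that the following holds. Let $G$ be a finite simple connected $4$-regular graph of order $n\ge N$ that has a vertex $x$ for which the subgraph $G[N_G(x)]$ induced by the neighborhood of $x$ is not isomorphic to $2K_2$ (the disjoint union of two copies of $K_2$). Then $G$ is isomorphic to the square $C_n^2$ of the cycle $C_n$ (the graph on $V(C_n)$ in which two distinct vertices are adjacent if their distance in $C_n$ is at most $2$), or $G$ has a minimal cutset $S$ with $|S|\le 4$ such that the average degree of the induced subgraph $G[S]$ is less than $1$. Here a set $S$ of vertices is a cutset of $G$ if $G-S$ is disconnected, and a cutset is minimal if no proper subset of it is a cutset. -/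

import Mathlib

namespace SimpleGraph

/-- A set `S` of vertices is a cutset of `G` if `G - S` is disconnected, that is, some two
vertices outside `S` are not joined by a walk in `G - S`. -/
def IsCutset {V : Type*} (G : SimpleGraph V) (S : Finset V) : Prop :=
  ¬ (G.induce ((S : Set V)ᶜ)).Preconnected

/-- A minimal cutset: a cutset no proper subset of which is a cutset. -/
def IsMinimalCutset {V : Type*} (G : SimpleGraph V) (S : Finset V) : Prop :=
  Minimal (fun T : Finset V => G.IsCutset T) S

/-- The average degree of a finite graph. -/
def avgDegree {W : Type*} [Fintype W] (H : SimpleGraph W) [DecidableRel H.Adj] : ℚ :=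
  (∑ w : W, (H.degree w : ℚ)) / (Fintype.card W : ℚ)

/-- The average degree of the subgraph `G[S]` of `G` induced by `S`. -/
def avgDegreeOn {V : Type*} (G : SimpleGraph V) [DecidableRel G.Adj] (S : Finset V) : ℚ :=
  (G.induce (S : Set V)).avgDegree

/-- The square of a graph: distinct vertices are adjacent if they are adjacent in `H` or have a
common neighbor in `H`, that is, if they are at distance at most two in `H`. -/
def square {W : Type*} (H : SimpleGraph W) : SimpleGraph W where
  Adj u v := u ≠ v ∧ (H.Adj u v ∨ ∃ w, H.Adj u w ∧ H.Adj w v)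
  symm := ⟨by
    rintro u v ⟨hne, h | ⟨w, h1, h2⟩⟩
    · exact ⟨hne.symm, Or.inl h.symm⟩
    · exact ⟨hne.symm, Or.inr ⟨w, h2.symm, h1.symm⟩⟩⟩
  loopless := ⟨fun _ h => h.1 rfl⟩

/-- The graph `2K₂`: the disjoint union of two copies of the complete graph on two vertices. -/
def twoK2 : SimpleGraph (Fin 2 ⊕ Fin 2) :=
  completeGraph (Fin 2) ⊕g completeGraph (Fin 2)

end SimpleGraph

/-! Suppose no minimal cutset of order at most 4 has average degree below 1. A separator `S` of
least order is a minimal cutset, so if its order is at most 4, its degree sum is at least `|S|`: one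
vertex is impossible, two vertices form an edge, and three or four vertices span at least two edges.
In a 4-regular graph, edges inside a cutset use up neighbors, so for orders 2 and 3 some vertex of
the cutset has a single neighbor on one side and can be replaced by it. Repeating this produces a
forbidden smaller cutset, so `G` is 4-connected (`not_separates_of_card_le_three`).

What remains is packaged in `WellLinked`: a small vertex set never has a boundary of three vertices,
and a boundary of four spans at least two edges. For the set `{x}` this gives two edges in the
neighborhood of `x`; if that neighborhood is not `2K₂`, two of its edges meet, and excluding
dominating vertices, triangles, 4-cycles and a path plus an isolated vertex leaves an induced path
`a b c d` (`exists_isPathAt`).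

By `adj_of_path` the neighborhood of `c` is then the path `b x d e`, so the window `a b x c d`
slides to `b x c d e` and generates an infinite sequence whose terms are adjacent to those at
distance 1 and 2. Finiteness makes it periodic (`exists_period`), connectivity makes it exhaust `G`,
and `G` is the square of a cycle. -/

namespace SimpleGraph

/-! ### Cutsets as separations -/

/-- `S` separates the nonempty set `A` from the rest of the graph, which is nonempty. -/
structure Separates {V : Type*} (G : SimpleGraph V) (S A : Finset V) : Prop where
  nonempty : A.Nonempty
  disj : ∀ v ∈ A, v ∉ S
  out : ∃ v, v ∉ A ∧ v ∉ S
  closed : ∀ u ∈ A, ∀ v, G.Adj u v → v ∈ A ∨ v ∈ S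

theorem Separates.isCutset {V : Type*} {G : SimpleGraph V} {S A : Finset V}
    (h : G.Separates S A) : G.IsCutset S := by
  intro hp
  obtain ⟨a, ha⟩ := h.nonempty
  obtain ⟨v, hvA, hvS⟩ := h.out
  have key : ∀ u w : ((S : Set V)ᶜ : Set V), (G.induce ((S : Set V)ᶜ)).Walk u w →
      u.1 ∈ A → w.1 ∈ A := by
    intro u w p
    induction p with
    | nil => exact id
    | @cons x y z hadj _ ih =>
      exact fun hu => ih ((h.closed x hu y hadj).resolve_right y.2)
  obtain ⟨p⟩ := hp ⟨a, h.disj a ha⟩ ⟨v, hvS⟩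
  exact hvA (key _ _ p ha)

theorem IsCutset.exists_separates {V : Type*} [Fintype V] {G : SimpleGraph V} {S : Finset V}
    (h : G.IsCutset S) : ∃ A, G.Separates S A := by
  classical
  unfold IsCutset Preconnected at h
  push Not at h
  obtain ⟨u, v, huv⟩ := h
  refine ⟨Finset.univ.filter fun w => ∃ hw : w ∈ ((S : Set V)ᶜ : Set V),
    (G.induce ((S : Set V)ᶜ)).Reachable u ⟨w, hw⟩, ?_, ?_, ?_, ?_⟩
  · exact ⟨u, Finset.mem_filter.2 ⟨Finset.mem_univ _, u.2, Reachable.refl u⟩⟩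
  · intro w hw
    obtain ⟨hw, -⟩ := (Finset.mem_filter.1 hw).2
    exact hw
  · refine ⟨v, ?_, v.2⟩
    intro hv
    obtain ⟨_, hr⟩ := (Finset.mem_filter.1 hv).2
    exact huv hr
  · intro w hw z hz
    obtain ⟨hw, hr⟩ := (Finset.mem_filter.1 hw).2
    by_cases hzS : z ∈ S
    · exact Or.inr hzS
    · refine Or.inl (Finset.mem_filter.2 ⟨Finset.mem_univ _, hzS, hr.trans ?_⟩)
      exact Adj.reachable (G := G.induce ((S : Set V)ᶜ)) (u := ⟨w, hw⟩) (v := ⟨z, hzS⟩) hz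

theorem avgDegreeOn_lt_one {V : Type*} [DecidableEq V] {G : SimpleGraph V} [DecidableRel G.Adj]
    {S : Finset V} (hS : S.Nonempty)
    (h : ∑ s ∈ S, (S.filter (G.Adj s)).card < S.card) : G.avgDegreeOn S < 1 := by
  unfold avgDegreeOn avgDegree
  have hpos : 0 < (Fintype.card (S : Set V) : ℚ) := by
    simpa [Fintype.card_pos_iff] using hS
  rw [div_lt_one hpos, ← Nat.cast_sum, Nat.cast_lt]
  have hdeg : ∀ w : (S : Set V), (G.induce (S : Set V)).degree w =
      (S.filter (G.Adj w)).card := by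
    intro w
    rw [← card_neighborFinset_eq_degree]
    refine Finset.card_bij (fun v _ => v.1) ?_ ?_ ?_
    · intro v hv
      rw [mem_neighborFinset] at hv
      exact Finset.mem_filter.2 ⟨v.2, hv⟩
    · intro v _ v' _ h
      exact Subtype.ext h
    · intro v hv
      obtain ⟨h1, h2⟩ := Finset.mem_filter.1 hv
      exact ⟨⟨v, h1⟩, by rw [mem_neighborFinset]; exact h2, rfl⟩
  calc _ = ∑ w : (S : Set V), (S.filter (G.Adj w)).card := Finset.sum_congr rfl fun w _ => hdeg w
    _ = ∑ s ∈ S, (S.filter (G.Adj s)).card :=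
      Finset.sum_coe_sort S fun s => (S.filter (G.Adj s)).card
    _ < S.card := h
    _ = _ := by simp

/-- No separator is smaller than `S`, so `S` is a minimal cutset and `hd` applies to it. -/
theorem Separates.degree_sum_ge {V : Type*} [Fintype V] [DecidableEq V] {G : SimpleGraph V}
    [DecidableRel G.Adj]
    (hd : ∀ S : Finset V, G.IsMinimalCutset S → S.card ≤ 4 → ¬ G.avgDegreeOn S < 1)
    {S A : Finset V} (h : G.Separates S A) (hS : S.Nonempty) (hS4 : S.card ≤ 4)
    (hmin : ∀ T B : Finset V, T.card < S.card → ¬ G.Separates T B) :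
    S.card ≤ ∑ s ∈ S, (S.filter (G.Adj s)).card := by
  by_contra! hlt
  refine hd S ⟨h.isCutset, fun T hT hTS => ?_⟩ hS4 (avgDegreeOn_lt_one hS hlt)
  rcases hTS.eq_or_ssubset with rfl | hss
  · exact le_rfl
  · obtain ⟨B, hB⟩ := IsCutset.exists_separates hT
    exact absurd hB (hmin T B (Finset.card_lt_card hss))

theorem Separates.compl {V : Type*} [Fintype V] [DecidableEq V] {G : SimpleGraph V}
    {S A : Finset V} (h : G.Separates S A) : G.Separates S (A ∪ S)ᶜ := by
  obtain ⟨⟨a, ha⟩, hd, ⟨v, hv⟩, hc⟩ := h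
  refine ⟨⟨v, by simp [hv]⟩, by simp +contextual, ⟨a, by simp [ha], hd a ha⟩, ?_⟩
  intro u hu w huw
  simp only [Finset.mem_compl, Finset.mem_union, not_or] at hu ⊢
  by_cases hwS : w ∈ S
  · exact Or.inr hwS
  · refine Or.inl ⟨fun hwA => ?_, hwS⟩
    have := hc w hwA u huw.symm
    tauto

/-- Four named neighbors of a vertex of a 4-regular graph, three of them given. -/
theorem IsRegularOfDegree.exists_fourth {V : Type*} [Fintype V] [DecidableEq V]
    {G : SimpleGraph V} [DecidableRel G.Adj] (hG : G.IsRegularOfDegree 4) {v p q r : V}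
    (hp : G.Adj v p) (hq : G.Adj v q) (hr : G.Adj v r) (hpq : p ≠ q) (hpr : p ≠ r)
    (hqr : q ≠ r) :
    ∃ s, s ≠ p ∧ s ≠ q ∧ s ≠ r ∧ ∀ w, G.Adj v w ↔ w = p ∨ w = q ∨ w = r ∨ w = s := by
  have h3 : ({p, q, r} : Finset V).card = 3 := by
    rw [Finset.card_eq_three]; exact ⟨p, q, r, hpq, hpr, hqr, rfl⟩
  have hsub : ({p, q, r} : Finset V) ⊆ G.neighborFinset v := by
    intro w hw
    simp only [Finset.mem_insert, Finset.mem_singleton] at hw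
    rw [mem_neighborFinset]
    rcases hw with rfl | rfl | rfl <;> assumption
  have h4 : (G.neighborFinset v).card = 4 := by rw [card_neighborFinset_eq_degree]; exact hG v
  have h1 : (G.neighborFinset v \ {p, q, r}).card = 1 := by
    rw [Finset.card_sdiff_of_subset hsub, h3, h4]
  obtain ⟨s, hs⟩ := Finset.card_eq_one.1 h1
  have hs' : ∀ w, (G.Adj v w ∧ ¬ (w = p ∨ w = q ∨ w = r)) ↔ w = s := by
    intro w
    have := congrArg (w ∈ ·) hs
    simpa only [Finset.mem_sdiff, mem_neighborFinset, Finset.mem_insert, Finset.mem_singleton,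
      eq_iff_iff] using this
  have hss := (hs' s).2 rfl
  refine ⟨s, by tauto, by tauto, by tauto, fun w => ?_⟩
  constructor
  · intro hw
    by_cases h : w = p ∨ w = q ∨ w = r
    · tauto
    · have := (hs' w).1 ⟨hw, h⟩
      tauto
  · rintro (rfl | rfl | rfl | rfl)
    exacts [hp, hq, hr, hss.1]

theorem IsRegularOfDegree.exists_notMem {V : Type*} [Fintype V] [DecidableEq V]
    {G : SimpleGraph V} [DecidableRel G.Adj] (hG : G.IsRegularOfDegree 4) (v : V) {S : Finset V}
    (hS : S.card ≤ 3) : ∃ w, G.Adj v w ∧ w ∉ S := by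
  by_contra! h
  have : G.neighborFinset v ⊆ S := fun w hw => h w (by simpa using hw)
  have h1 := Finset.card_le_card this
  rw [card_neighborFinset_eq_degree, hG v] at h1
  omega

theorem IsRegularOfDegree.exists_neighbors {V : Type*} [Fintype V] [DecidableEq V]
    {G : SimpleGraph V} [DecidableRel G.Adj] (hG : G.IsRegularOfDegree 4) (v : V) :
    ∃ p q r s, p ≠ q ∧ p ≠ r ∧ q ≠ r ∧ s ≠ p ∧ s ≠ q ∧ s ≠ r ∧
      ∀ w, G.Adj v w ↔ w = p ∨ w = q ∨ w = r ∨ w = s := by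
  obtain ⟨p, hp, -⟩ := hG.exists_notMem v (S := ∅) (by simp)
  obtain ⟨q, hq, hqp⟩ := hG.exists_notMem v (S := {p}) (by simp)
  obtain ⟨r, hr, hrp⟩ := hG.exists_notMem v (S := {p, q})
    ((Finset.card_insert_le _ _).trans (by simp))
  simp only [Finset.mem_insert, Finset.mem_singleton, not_or] at hqp hrp
  obtain ⟨s, hs⟩ := hG.exists_fourth hp hq hr (Ne.symm hqp) (Ne.symm hrp.1) (Ne.symm hrp.2)
  exact ⟨p, q, r, s, Ne.symm hqp, Ne.symm hrp.1, Ne.symm hrp.2, hs⟩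

/-- Replacing a vertex `s` of a separator by its only neighbor `t` on the side `A`. -/
theorem Separates.shift {V : Type*} [Fintype V] [DecidableEq V] {G : SimpleGraph V}
    [DecidableRel G.Adj] (hG : G.IsRegularOfDegree 4) {S T A : Finset V} (h : G.Separates S A)
    (hS : S.card ≤ 3) {t : V} (ht : t ∈ A) (hT : ∀ v ∈ T, v ∈ S ∨ v = t) (htT : t ∈ T)
    (hST : ∀ s ∈ S, s ∉ T → ∀ v ∈ A, G.Adj s v → v = t) : G.Separates T (A.erase t) := by
  obtain ⟨-, hd, ⟨o, ho⟩, hc⟩ := h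
  refine ⟨?_, ?_, ⟨o, ?_, ?_⟩, ?_⟩
  -- At most three of the four neighbors of `t` lie in `S`, so one is left in `A.erase t`.
  · obtain ⟨w, hw, hwS⟩ := hG.exists_notMem t hS
    exact ⟨w, Finset.mem_erase.2 ⟨hw.ne', (hc t ht w hw).resolve_right hwS⟩⟩
  · intro v hv hvT
    obtain ⟨h1, h2⟩ := Finset.mem_erase.1 hv
    exact (hT v hvT).elim (hd v h2) h1
  · exact fun h => ho.1 (Finset.mem_of_mem_erase h)
  · exact fun h => (hT o h).elim ho.2 (fun h => ho.1 (h ▸ ht))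
  · intro u hu v huv
    obtain ⟨h1, h2⟩ := Finset.mem_erase.1 hu
    rw [Finset.mem_erase]
    by_cases hvT : v ∈ T
    · exact Or.inr hvT
    rcases hc u h2 v huv with h3 | h3
    · exact Or.inl ⟨fun h => hvT (h ▸ htT), h3⟩
    · exact absurd (hST v h3 hvT u h2 huv.symm) h1

/-- Otherwise `S.erase s` would still separate `A`. -/
theorem Separates.exists_adj {V : Type*} [DecidableEq V] {G : SimpleGraph V} {S A : Finset V}
    (h : G.Separates S A) {s : V} (hs : s ∈ S) {k : ℕ} (hk : S.card ≤ k + 1)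
    (hmin : ∀ T B : Finset V, T.card ≤ k → ¬ G.Separates T B)
    (hout : ∃ v, v ∉ A ∧ v ∉ S) : ∃ v ∈ A, G.Adj s v := by
  by_contra! hno
  refine hmin (S.erase s) A (by rw [Finset.card_erase_of_mem hs]; omega)
    ⟨h.nonempty, fun v hv h' => h.disj v hv (Finset.mem_of_mem_erase h'), ?_, ?_⟩
  · obtain ⟨v, h1, h2⟩ := hout
    exact ⟨v, h1, fun h => h2 (Finset.mem_of_mem_erase h)⟩
  · intro u hu v huv
    rcases h.closed u hu v huv with h1 | h1
    · exact Or.inl h1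
    · refine Or.inr (Finset.mem_erase.2 ⟨?_, h1⟩)
      rintro rfl
      exact hno u hu huv.symm

/-! ### Exclusion of cutsets of order at most three -/

theorem not_separates_of_card_le_one {V : Type*} [Fintype V] [DecidableEq V] {G : SimpleGraph V}
    [DecidableRel G.Adj] (hG : G.Connected)
    (hd : ∀ S : Finset V, G.IsMinimalCutset S → S.card ≤ 4 → ¬ G.avgDegreeOn S < 1) :
    ∀ S A : Finset V, S.card ≤ 1 → ¬ G.Separates S A := by
  have h0 : ∀ S A : Finset V, S.card ≤ 0 → ¬ G.Separates S A := by
    intro S A hS h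
    obtain rfl : S = ∅ := by simpa using hS
    obtain ⟨a, ha⟩ := h.nonempty
    obtain ⟨v, hv, -⟩ := h.out
    obtain ⟨p⟩ := hG.preconnected a v
    have key : ∀ u w : V, G.Walk u w → u ∈ A → w ∈ A := by
      intro u w p
      induction p with
      | nil => exact id
      | cons hadj _ ih => exact fun hu => ih (by simpa using h.closed _ hu _ hadj)
    exact hv (key _ _ p ha)
  intro S A hS h
  rcases S.eq_empty_or_nonempty with rfl | hne
  · exact h0 _ _ (by simp) h
  have hc : S.card = 1 := by have := hne.card_pos; omega
  have := h.degree_sum_ge hd hne (by omega) (fun T B hT => h0 T B (by omega))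
  obtain ⟨s, rfl⟩ := Finset.card_eq_one.1 hc
  simp [Finset.filter_singleton] at this

/-- At least two of the six pairs of vertices among four are adjacent. -/
def TwoEdges {V : Type*} (G : SimpleGraph V) (p q r s : V) : Prop :=
  (G.Adj p q ∨ G.Adj p r ∨ G.Adj p s ∨ G.Adj q r ∨ G.Adj q s) ∧
  (G.Adj p q ∨ G.Adj p r ∨ G.Adj p s ∨ G.Adj q r ∨ G.Adj r s) ∧
  (G.Adj p q ∨ G.Adj p r ∨ G.Adj p s ∨ G.Adj q s ∨ G.Adj r s) ∧
  (G.Adj p q ∨ G.Adj p r ∨ G.Adj q r ∨ G.Adj q s ∨ G.Adj r s) ∧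
  (G.Adj p q ∨ G.Adj p s ∨ G.Adj q r ∨ G.Adj q s ∨ G.Adj r s) ∧
  (G.Adj p r ∨ G.Adj p s ∨ G.Adj q r ∨ G.Adj q s ∨ G.Adj r s)

theorem adj_of_sum_pair {V : Type*} [DecidableEq V] {G : SimpleGraph V} [DecidableRel G.Adj]
    {a b : V} (hab : a ≠ b)
    (h : 2 ≤ ∑ s ∈ ({a, b} : Finset V), (({a, b} : Finset V).filter (G.Adj s)).card) :
    G.Adj a b := by
  by_contra hn
  have hn' : ¬ G.Adj b a := fun h => hn h.symm
  rw [Finset.sum_pair hab] at h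
  simp [Finset.filter_insert, Finset.filter_singleton, hn, hn'] at h

/-- A degree sum is even, so 3 means at least 4: two of the three pairs are edges. -/
theorem adj_of_sum_triple {V : Type*} [DecidableEq V] {G : SimpleGraph V} [DecidableRel G.Adj]
    {a b c : V} (hab : a ≠ b) (hac : a ≠ c) (hbc : b ≠ c)
    (h : 3 ≤ ∑ s ∈ ({a, b, c} : Finset V), (({a, b, c} : Finset V).filter (G.Adj s)).card) :
    (G.Adj a b ∨ G.Adj a c) ∧ (G.Adj a b ∨ G.Adj b c) ∧ (G.Adj a c ∨ G.Adj b c) := by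
  rw [Finset.sum_insert (by simp [hab, hac]), Finset.sum_pair hbc] at h
  simp only [Finset.filter_insert, Finset.filter_singleton, G.adj_comm b a, G.adj_comm c a,
    G.adj_comm c b, SimpleGraph.irrefl, if_false] at h
  by_cases h1 : G.Adj a b <;> by_cases h2 : G.Adj a c <;> by_cases h3 : G.Adj b c <;>
    simp [h1, h2, h3] at h ⊢

theorem twoEdges_of_sum {V : Type*} [DecidableEq V] {G : SimpleGraph V} [DecidableRel G.Adj]
    {a b c d : V} (hab : a ≠ b) (hac : a ≠ c) (had : a ≠ d) (hbc : b ≠ c) (hbd : b ≠ d)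
    (hcd : c ≠ d)
    (h : 4 ≤ ∑ s ∈ ({a, b, c, d} : Finset V),
      (({a, b, c, d} : Finset V).filter (G.Adj s)).card) :
    G.TwoEdges a b c d := by
  rw [Finset.sum_insert (by simp [hab, hac, had]), Finset.sum_insert (by simp [hbc, hbd]),
    Finset.sum_pair hcd] at h
  simp only [Finset.filter_insert, Finset.filter_singleton, G.adj_comm b a, G.adj_comm c a,
    G.adj_comm c b, G.adj_comm d a, G.adj_comm d b, G.adj_comm d c, SimpleGraph.irrefl,
    if_false] at h
  unfold TwoEdges
  by_cases h1 : G.Adj a b <;> by_cases h2 : G.Adj a c <;> by_cases h3 : G.Adj a d <;>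
    by_cases h4 : G.Adj b c <;> by_cases h5 : G.Adj b d <;> by_cases h6 : G.Adj c d <;>
    simp [h1, h2, h3, h4, h5, h6] at h ⊢

theorem Separates.exists_other_side {V : Type*} [Fintype V] [DecidableEq V] {G : SimpleGraph V}
    {S A : Finset V} (h : G.Separates S A) :
    ∃ B, G.Separates S B ∧ ∀ v, v ∉ S → (v ∈ B ↔ v ∉ A) :=
  ⟨_, h.compl, by simp +contextual⟩

theorem card_pair_le {V : Type*} [DecidableEq V] (a b : V) : ({a, b} : Finset V).card ≤ 2 :=
  (Finset.card_insert_le _ _).trans (by simp)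

theorem card_triple_le {V : Type*} [DecidableEq V] (a b c : V) :
    ({a, b, c} : Finset V).card ≤ 3 :=
  (Finset.card_insert_le _ _).trans (by have := card_pair_le b c; omega)

section SmallCuts

variable {V : Type*} [Fintype V] [DecidableEq V] {G : SimpleGraph V} [DecidableRel G.Adj]

/-- Besides `b`, the vertex `a` has three neighbors, so exactly one on some side. Induction on the
size of `A` rules out that this side is `A`; hence `a` and, symmetrically, `b` have one neighbor
each in `B`. -/
theorem not_separates_pair (hreg : G.IsRegularOfDegree 4)
    (h1 : ∀ S A : Finset V, S.card ≤ 1 → ¬ G.Separates S A)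
    (hadj : ∀ (a b : V) (A : Finset V), G.Separates {a, b} A → G.Adj a b) (n : ℕ) :
    ∀ (a b : V) (A : Finset V), A.card = n → ¬ G.Separates {a, b} A := by
  induction n using Nat.strong_induction_on with
  | _ n ih =>
    have main : ∀ (a b : V) (A B : Finset V), A.card = n → G.Separates {a, b} A →
        G.Separates {a, b} B → (∀ v, v ∉ ({a, b} : Finset V) → (v ∈ B ↔ v ∉ A)) →
        ∃ t ∈ B, G.Adj a t ∧ ∀ v ∈ B, G.Adj a v → v = t := by
      intro a b A B hA hSA hSB hAB
      have hab := hadj a b A hSA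
      obtain ⟨p, hpA, hap⟩ := hSA.exists_adj (s := a) (by simp) (card_pair_le a b) h1 hSA.out
      obtain ⟨q, hqB, haq⟩ := hSB.exists_adj (s := a) (by simp) (card_pair_le a b) h1 hSB.out
      have hpS := hSA.disj p hpA
      have hqS := hSB.disj q hqB
      have hqA := (hAB q hqS).1 hqB
      simp only [Finset.mem_insert, Finset.mem_singleton, not_or] at hpS hqS
      obtain ⟨r, hrb, hrp, hrq, hN⟩ := hreg.exists_fourth hab hap haq (Ne.symm hpS.2)
        (Ne.symm hqS.2) (by rintro rfl; exact hqA hpA)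
      have har : G.Adj a r := (hN r).2 (by simp)
      have hra : r ≠ a := har.ne'
      by_cases hrA : r ∈ A
      · have hB : ∀ v, v ∈ B → v ∉ A ∧ v ≠ b := fun v hv =>
          ⟨(hAB v (hSB.disj v hv)).1 hv, fun h => hSB.disj v hv (by simp [h])⟩
        refine ⟨q, hqB, haq, fun v hv hav => ?_⟩
        have := hB v hv
        rcases (hN v).1 hav with rfl | rfl | rfl | rfl <;> tauto
      · exfalso
        -- Here `p` is the only neighbor of `a` in `A`, so `{p, b}` cuts off the smaller set
        -- `A.erase p`.
        have hA' : ∀ v, v ∈ A → v ≠ b := fun v hv h => hSA.disj v hv (by simp [h])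
        refine ih (A.erase p).card ?_ p b _ rfl
          (hSA.shift hreg ((card_pair_le a b).trans (by omega)) hpA (T := {p, b}) ?_ (by simp) ?_)
        · rw [← hA]; exact Finset.card_erase_lt_of_mem hpA
        · simp
        · intro s hs hsT v hv hav
          simp only [Finset.mem_insert, Finset.mem_singleton, not_or] at hs hsT
          obtain rfl : s = a := by tauto
          have := hA' v hv
          rcases (hN v).1 hav with rfl | rfl | rfl | rfl <;> tauto
    intro a b A hA hSA
    obtain ⟨B, hSB, hAB⟩ := hSA.exists_other_side
    obtain ⟨p, hpB, hap, hp⟩ := main a b A B hA hSA hSB hAB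
    obtain ⟨q, hqB, hbq, hq⟩ := main b a A B hA (by rwa [Finset.pair_comm])
      (by rwa [Finset.pair_comm]) (by rwa [Finset.pair_comm])
    have hsep : G.Separates {p, b} (B.erase p) :=
      hSB.shift hreg ((card_pair_le a b).trans (by omega)) hpB (by simp) (by simp) (by
        intro s hs hsT v hv hav
        simp only [Finset.mem_insert, Finset.mem_singleton, not_or] at hs hsT
        obtain rfl : s = a := by tauto
        exact hp v hv hav)
    -- The new cutset is again an edge, so the neighbors of `a` and `b` in `B` coincide and form a
    -- cutvertex.
    have hpb := hadj _ _ _ hsep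
    obtain rfl := hq p hpB hpb.symm
    refine h1 {p} (B.erase p) (by simp)
      (hSB.shift hreg ((card_pair_le a b).trans (by omega)) hpB (by simp) (by simp) ?_)
    intro s hs hsT v hv hav
    simp only [Finset.mem_insert, Finset.mem_singleton] at hs
    rcases hs with rfl | rfl
    · exact hp v hv hav
    · exact hq v hv hav

theorem not_separates_of_card_le_two (hreg : G.IsRegularOfDegree 4) (hG : G.Connected)
    (hd : ∀ S : Finset V, G.IsMinimalCutset S → S.card ≤ 4 → ¬ G.avgDegreeOn S < 1) :
    ∀ S A : Finset V, S.card ≤ 2 → ¬ G.Separates S A := by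
  have h1 := not_separates_of_card_le_one hG hd
  intro S A hS h
  by_cases hS1 : S.card ≤ 1
  · exact h1 S A hS1 h
  obtain ⟨a, b, -, rfl⟩ := Finset.card_eq_two.1 (show S.card = 2 by omega)
  refine not_separates_pair hreg h1 ?_ _ a b A rfl h
  intro a b A h
  by_cases hab : a = b
  · subst hab
    exact absurd h (h1 _ _ (by simp))
  have hc := Finset.card_pair hab
  refine adj_of_sum_pair hab ?_
  have := h.degree_sum_ge hd (by simp) (by omega) (fun T B hT => h1 T B (by omega))
  omega

/-- Both vertices of the cutset other than `u` reach `A` only through `t`, so `{t, u}` is a cutset.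
-/
theorem Separates.false_of_funnel {a b c t u : V} {A : Finset V} (hA : G.Separates {a, b, c} A)
    (hreg : G.IsRegularOfDegree 4) (h2 : ∀ S A : Finset V, S.card ≤ 2 → ¬ G.Separates S A)
    (ht : t ∈ A) (hu : u = a ∨ u = b ∨ u = c)
    (h : ∀ s, (s = a ∨ s = b ∨ s = c) → s ≠ u → ∀ v ∈ A, G.Adj s v → v = t) : False := by
  refine h2 {t, u} _ (card_pair_le _ _)
    (hA.shift hreg (card_triple_le a b c) ht (T := {t, u}) ?_ (by simp) ?_)
  · rintro v hv
    simp only [Finset.mem_insert, Finset.mem_singleton] at hv ⊢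
    rcases hv with rfl | rfl
    · exact Or.inr rfl
    · exact Or.inl hu
  · intro s hs hsT
    simp only [Finset.mem_insert, Finset.mem_singleton, not_or] at hs hsT
    exact h s hs hsT.2

/-- The middle vertex `b` has exactly one neighbor on each side, and replacing it by either gives
another 3-cutset, which spans two edges. These edges make two vertices of the original cutset share
their only neighbor on one side, a funnel. -/
theorem not_separates_path (hreg : G.IsRegularOfDegree 4)
    (h2 : ∀ S A : Finset V, S.card ≤ 2 → ¬ G.Separates S A)
    (hadj : ∀ (a b c : V) (A : Finset V), G.Separates {a, b, c} A →
      (G.Adj a b ∨ G.Adj a c) ∧ (G.Adj a b ∨ G.Adj b c) ∧ (G.Adj a c ∨ G.Adj b c))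
    {a b c : V} {A : Finset V} (hab : G.Adj a b) (hbc : G.Adj b c) (hac : a ≠ c) :
    ¬ G.Separates {a, b, c} A := by
  intro hA
  obtain ⟨B, hB, hAB⟩ := hA.exists_other_side
  have hcard := card_triple_le a b c
  have hSA : ∀ v ∈ A, v ≠ a ∧ v ≠ b ∧ v ≠ c ∧ v ∉ B := by
    intro v hv
    have := hA.disj v hv
    have h' := hAB v this
    simp only [Finset.mem_insert, Finset.mem_singleton, not_or] at this
    grind
  have hSB : ∀ v ∈ B, v ≠ a ∧ v ≠ b ∧ v ≠ c := by
    intro v hv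
    have := hB.disj v hv
    simp only [Finset.mem_insert, Finset.mem_singleton, not_or] at this
    grind
  have hcov : ∀ v, v = a ∨ v = b ∨ v = c ∨ v ∈ A ∨ v ∈ B := by
    intro v
    have := hAB v
    simp only [Finset.mem_insert, Finset.mem_singleton, not_or] at this
    grind
  obtain ⟨aA, haA, haaA⟩ := hA.exists_adj (s := a) (by simp) hcard h2 hA.out
  obtain ⟨aB, haB, haaB⟩ := hB.exists_adj (s := a) (by simp) hcard h2 hB.out
  obtain ⟨bA, hbA, hbbA⟩ := hA.exists_adj (s := b) (by simp) hcard h2 hA.out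
  obtain ⟨bB, hbB, hbbB⟩ := hB.exists_adj (s := b) (by simp) hcard h2 hB.out
  obtain ⟨cA, hcA, hccA⟩ := hA.exists_adj (s := c) (by simp) hcard h2 hA.out
  obtain ⟨cB, hcB, hccB⟩ := hB.exists_adj (s := c) (by simp) hcard h2 hB.out
  have hAneB : ∀ v ∈ A, ∀ w ∈ B, v ≠ w := by
    rintro v hv w hw rfl
    exact (hSA v hv).2.2.2 hw
  obtain ⟨b', hb'a, hb'c, hb'A, hNb⟩ := hreg.exists_fourth hab.symm hbc hbbA hac
    (hSA _ hbA).1.symm (hSA _ hbA).2.2.1.symm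
  obtain rfl : bB = b' := by
    have := (hNb bB).1 hbbB
    have := hSB bB hbB
    have := hAneB _ hbA _ hbB
    grind
  have hbA' : ∀ v ∈ A, G.Adj b v → v = bA := by
    intro v hv hbv
    have := (hNb v).1 hbv
    have := hSA v hv
    have := hAneB _ hv _ hbB
    grind
  have hbB' : ∀ v ∈ B, G.Adj b v → v = bB := by
    intro v hv hbv
    have := (hNb v).1 hbv
    have := hSB v hv
    have := hAneB _ hbA _ hv
    grind
  have sA := hadj a bA c _ (hA.shift hreg hcard hbA (T := {a, bA, c}) (by simp) (by simp) (by
    intro s hs hsT v hv hav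
    simp only [Finset.mem_insert, Finset.mem_singleton, not_or] at hs hsT
    obtain rfl : s = b := by grind
    exact hbA' v hv hav))
  have sB := hadj a bB c _ (hB.shift hreg hcard hbB (T := {a, bB, c}) (by simp) (by simp) (by
    intro s hs hsT v hv hav
    simp only [Finset.mem_insert, Finset.mem_singleton, not_or] at hs hsT
    obtain rfl : s = b := by grind
    exact hbB' v hv hav))
  by_cases hac' : G.Adj a c
  · obtain ⟨a', -, -, -, hNa⟩ := hreg.exists_fourth hab hac' haaA hbc.ne
      (hSA _ haA).2.1.symm (hSA _ haA).2.2.1.symm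
    obtain ⟨c', -, -, -, hNc⟩ := hreg.exists_fourth hac'.symm hbc.symm hccA hab.ne
      (hSA _ hcA).1.symm (hSA _ hcA).2.1.symm
    have haA' : ∀ v ∈ A, G.Adj a v → v = aA := by
      intro v hv hbv
      have := (hNa v).1 hbv
      have := (hNa aB).1 haaB
      have := hSA v hv
      have := hSB _ haB
      have := hAneB _ hv _ haB
      have := hAneB _ haA _ haB
      grind
    have hcA' : ∀ v ∈ A, G.Adj c v → v = cA := by
      intro v hv hbv
      have := (hNc v).1 hbv
      have := (hNc cB).1 hccB
      have := hSA v hv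
      have := hSB _ hcB
      have := hAneB _ hv _ hcB
      have := hAneB _ hcA _ hcB
      grind
    have sC := hadj a b cA _ (hA.shift hreg hcard hcA (T := {a, b, cA}) (by simp)
      (by simp) (by
        intro s hs hsT v hv hav
        simp only [Finset.mem_insert, Finset.mem_singleton, not_or] at hs hsT
        obtain rfl : s = c := by grind
        exact hcA' v hv hav))
    rcases sC.2.2 with h | h
    · obtain rfl := haA' _ hcA h
      refine hA.false_of_funnel hreg h2 hcA (u := b) (by simp) ?_
      rintro s (rfl | rfl | rfl) hs
      exacts [haA', absurd rfl hs, hcA']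
    · obtain rfl := hbA' _ hcA h
      refine hA.false_of_funnel hreg h2 hcA (u := a) (by simp) ?_
      rintro s (rfl | rfl | rfl) hs
      exacts [absurd rfl hs, hbA', hcA']
  -- Without the edge `ac`, both shifted cutsets must be paths centered at `bA` and `bB`. The fourth
  -- neighbor of `a` spoils at most one side; on the other, `a` and `b` funnel.
  · have h3 : G.Adj a bA := by grind
    have h4 : G.Adj a bB := by grind
    obtain ⟨a', h5, h6, h7, hNa⟩ := hreg.exists_fourth hab h3 h4 hbbA.ne hbbB.ne
      (hAneB _ hbA _ hbB)
    by_cases ha' : a' ∈ A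
    · refine hB.false_of_funnel hreg h2 hbB (u := c) (by simp) ?_
      rintro s (rfl | rfl | rfl) hs
      · intro v hv hav
        have := (hNa v).1 hav
        have := hSB v hv
        have := hAneB _ hbA v hv
        have := hAneB _ ha' v hv
        grind
      · exact hbB'
      · exact absurd rfl hs
    · refine hA.false_of_funnel hreg h2 hbA (u := c) (by simp) ?_
      rintro s (rfl | rfl | rfl) hs
      · intro v hv hav
        have := (hNa v).1 hav
        have := hSA v hv
        have := hAneB v hv _ hbB
        have : v ≠ a' := by rintro rfl; exact ha' hv
        grind
      · exact hbA'
      · exact absurd rfl hs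

theorem not_separates_of_card_le_three (hreg : G.IsRegularOfDegree 4) (hG : G.Connected)
    (hd : ∀ S : Finset V, G.IsMinimalCutset S → S.card ≤ 4 → ¬ G.avgDegreeOn S < 1) :
    ∀ S A : Finset V, S.card ≤ 3 → ¬ G.Separates S A := by
  have h2 := not_separates_of_card_le_two hreg hG hd
  have hadj : ∀ (a b c : V) (A : Finset V), G.Separates {a, b, c} A →
      (G.Adj a b ∨ G.Adj a c) ∧ (G.Adj a b ∨ G.Adj b c) ∧ (G.Adj a c ∨ G.Adj b c) := by
    intro a b c A h
    have hc : ({a, b, c} : Finset V).card = 3 := by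
      have := card_triple_le a b c
      by_contra hne
      exact h2 _ _ (by omega) h
    have hab : a ≠ b := by
      rintro rfl
      rw [Finset.insert_idem] at hc
      have := card_pair_le a c
      omega
    have hbc : b ≠ c := by
      rintro rfl
      rw [Finset.pair_eq_singleton] at hc
      have := card_pair_le a b
      omega
    have hac : a ≠ c := by
      rintro rfl
      rw [Finset.pair_comm b a, Finset.insert_idem] at hc
      have := card_pair_le a b
      omega
    refine adj_of_sum_triple hab hac hbc ?_
    have := h.degree_sum_ge hd (by simp) (by omega) (fun T B hT => h2 T B (by omega))
    omega
  intro S A hS h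
  by_cases hS1 : S.card ≤ 2
  · exact h2 S A hS1 h
  obtain ⟨a, b, c, hab, hac, hbc, rfl⟩ := Finset.card_eq_three.1 (show S.card = 3 by omega)
  have key := hadj a b c A h
  by_cases h1 : G.Adj a b
  · by_cases h3 : G.Adj b c
    · exact not_separates_path hreg h2 hadj h1 h3 hac h
    · refine not_separates_path hreg h2 hadj h1.symm (by tauto : G.Adj a c) hbc (A := A) ?_
      rwa [Finset.insert_comm]
  · refine not_separates_path hreg h2 hadj (by tauto : G.Adj a c) (by tauto : G.Adj b c).symm
      hab (A := A) ?_
    rwa [Finset.pair_comm]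

end SmallCuts

/-! ### Local form of the connectivity and density conditions -/

/-- The local consequences of 4-regularity, of 4-connectivity and of the density of the
4-vertex cutsets that the structure theory uses. -/
structure WellLinked {V : Type*} (G : SimpleGraph V) : Prop where
  fourth : ∀ {v p q r : V}, G.Adj v p → G.Adj v q → G.Adj v r → p ≠ q → p ≠ r → q ≠ r →
    ∃ s, s ≠ p ∧ s ≠ q ∧ s ≠ r ∧ ∀ w, G.Adj v w ↔ w = p ∨ w = q ∨ w = r ∨ w = s
  three : ∀ (W : Finset V) (p q r : V), W.Nonempty → W.card ≤ 10 →
    (∀ w ∈ W, ∀ v, G.Adj w v → v ∈ W ∨ v = p ∨ v = q ∨ v = r) → False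
  four : ∀ (W : Finset V) (p q r s : V), W.Nonempty → W.card ≤ 10 →
    p ∉ W → q ∉ W → r ∉ W → s ∉ W →
    (∀ w ∈ W, ∀ v, G.Adj w v → v ∈ W ∨ v = p ∨ v = q ∨ v = r ∨ v = s) → G.TwoEdges p q r s

theorem wellLinked {V : Type*} [Fintype V] [DecidableEq V] {G : SimpleGraph V}
    [DecidableRel G.Adj] (hcard : 20 ≤ Fintype.card V)
    (hreg : G.IsRegularOfDegree 4) (hG : G.Connected)
    (hd : ∀ S : Finset V, G.IsMinimalCutset S → S.card ≤ 4 → ¬ G.avgDegreeOn S < 1) :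
    G.WellLinked := by
  have h3 := not_separates_of_card_le_three hreg hG hd
  -- The boundary and the set have at most 14 of the at least 20 vertices. The bound 10 is ample:
  -- the sets used below have at most seven vertices.
  have hout : ∀ W S : Finset V, W.card ≤ 10 → S.card ≤ 4 → ∃ v, v ∉ W ∧ v ∉ S := by
    intro W S hW hS
    by_contra! h
    have h1 : (Finset.univ : Finset V) ⊆ W ∪ S := by
      intro v _
      rw [Finset.mem_union]
      have := h v
      tauto
    have h2 := Finset.card_le_card h1
    have := Finset.card_union_le W S
    rw [Finset.card_univ] at h2
    omega
  have three : ∀ (W : Finset V) (p q r : V), W.Nonempty → W.card ≤ 10 →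
      (∀ w ∈ W, ∀ v, G.Adj w v → v ∈ W ∨ v = p ∨ v = q ∨ v = r) → False := by
    intro W p q r hne hW h
    have hc := card_triple_le p q r
    refine h3 ({p, q, r} \ W) W ((Finset.card_le_card Finset.sdiff_subset).trans hc)
      ⟨hne, by simp +contextual, ?_, ?_⟩
    · obtain ⟨v, hv, hv'⟩ := hout W {p, q, r} hW (by omega)
      exact ⟨v, hv, fun h => hv' (Finset.mem_sdiff.1 h).1⟩
    · intro u hu v huv
      have := h u hu v huv
      simp
      tauto
  refine ⟨hreg.exists_fourth, three, ?_⟩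
  intro W p q r s hne hW hp hq hr hs h
  -- If two boundary vertices coincide, the boundary has at most three vertices.
  have hpq : p ≠ q := by rintro rfl; exact three W p r s hne hW (fun w hw v hv => by
    have := h w hw v hv; tauto)
  have hpr : p ≠ r := by rintro rfl; exact three W p q s hne hW (fun w hw v hv => by
    have := h w hw v hv; tauto)
  have hps : p ≠ s := by rintro rfl; exact three W p q r hne hW (fun w hw v hv => by
    have := h w hw v hv; tauto)
  have hqr : q ≠ r := by rintro rfl; exact three W p q s hne hW (fun w hw v hv => by
    have := h w hw v hv; tauto)
  have hqs : q ≠ s := by rintro rfl; exact three W p q r hne hW (fun w hw v hv => by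
    have := h w hw v hv; tauto)
  have hrs : r ≠ s := by rintro rfl; exact three W p q r hne hW (fun w hw v hv => by
    have := h w hw v hv; tauto)
  have hc : ({p, q, r, s} : Finset V).card = 4 :=
    Finset.card_eq_of_equiv_fin (by
      have := Finset.card_eq_three.2 ⟨q, r, s, hqr, hqs, hrs, rfl⟩
      exact Finset.equivFinOfCardEq (by rw [Finset.card_insert_of_notMem (by simp [*]), this]))
  have hsep : G.Separates {p, q, r, s} W := by
    refine ⟨hne, ?_, hout W _ hW hc.le, ?_⟩
    · intro v hv
      simp only [Finset.mem_insert, Finset.mem_singleton, not_or]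
      refine ⟨?_, ?_, ?_, ?_⟩ <;> (rintro rfl; contradiction)
    · intro u hu v huv
      simpa using h u hu v huv
  refine twoEdges_of_sum hpq hpr hps hqr hqs hrs ?_
  have := hsep.degree_sum_ge hd (by simp) hc.le (fun T B hT => h3 T B (by omega))
  omega

/-- `p, q, r, s` are the neighbors of `v`, each listed once. -/
def HasNeighbors {V : Type*} (G : SimpleGraph V) (v p q r s : V) : Prop :=
  (p ≠ q ∧ p ≠ r ∧ p ≠ s ∧ q ≠ r ∧ q ≠ s ∧ r ≠ s) ∧ (v ≠ p ∧ v ≠ q ∧ v ≠ r ∧ v ≠ s) ∧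
    ∀ w, G.Adj v w ↔ w = p ∨ w = q ∨ w = r ∨ w = s

/-! ### Possible neighborhoods of a vertex -/

namespace WellLinked

variable {V : Type*} {G : SimpleGraph V}

theorem exists_hasNeighbors (H : G.WellLinked) {v p q r : V} (hp : G.Adj v p) (hq : G.Adj v q)
    (hr : G.Adj v r) (hpq : p ≠ q) (hpr : p ≠ r) (hqr : q ≠ r) :
    ∃ s, G.HasNeighbors v p q r s := by
  obtain ⟨s, h1, h2, h3, h⟩ := H.fourth hp hq hr hpq hpr hqr
  have hs : G.Adj v s := (h s).2 (by simp)
  exact ⟨s, ⟨hpq, hpr, h1.symm, hqr, h2.symm, h3.symm⟩, ⟨hp.ne, hq.ne, hr.ne, hs.ne⟩, h⟩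

theorem not_three (H : G.WellLinked) (l : List V) (p q r : V) (hl : l ≠ []) (hc : l.length ≤ 10)
    (h : ∀ w ∈ l, ∀ v, G.Adj w v → v ∈ l ∨ v = p ∨ v = q ∨ v = r) : False := by
  classical
  exact H.three l.toFinset p q r (by simpa using hl) (l.toFinset_card_le.trans hc)
    (by simpa using h)

theorem twoEdges (H : G.WellLinked) (l : List V) (p q r s : V) (hl : l ≠ [])
    (hc : l.length ≤ 10) (hS : p ∉ l ∧ q ∉ l ∧ r ∉ l ∧ s ∉ l)
    (h : ∀ w ∈ l, ∀ v, G.Adj w v → v ∈ l ∨ v = p ∨ v = q ∨ v = r ∨ v = s) :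
    G.TwoEdges p q r s := by
  classical
  obtain ⟨hp, hq, hr, hs⟩ := hS
  exact H.four l.toFinset p q r s (by simpa using hl) (l.toFinset_card_le.trans hc)
    (by simpa using hp) (by simpa using hq) (by simpa using hr) (by simpa using hs)
    (by simpa using h)

/-- The set `{x, a}` would have boundary `b, c, d`. -/
theorem not_dominated (H : G.WellLinked) {x a b c d : V} (hx : G.HasNeighbors x a b c d)
    (hb : G.Adj a b) (hc : G.Adj a c) (hd : G.Adj a d) : False := by
  obtain ⟨⟨h1, h2, h3, h4, h5, h6⟩, hx', hx⟩ := hx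
  have hax : G.Adj a x := ((hx a).2 (by simp)).symm
  obtain ⟨y, -, -, ha⟩ := H.exists_hasNeighbors hb hc hd h4 h5 h6
  exact H.not_three [x, a] b c d (by simp) (by simp) (by grind [G.adj_comm])

theorem not_fourCycle (H : G.WellLinked) {x a b c d : V} (hx : G.HasNeighbors x a b c d)
    (hab : G.Adj a b) (hbc : G.Adj b c) (hcd : G.Adj c d) (hda : G.Adj d a) : False := by
  have hac : ¬ G.Adj a c := fun h => H.not_dominated hx hab h hda.symm
  obtain ⟨hxd, hx', hx⟩ := hx
  have hbd : ¬ G.Adj b d := fun h => H.not_dominated (x := x) (a := b) (b := a) (c := c) (d := d)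
    ⟨by grind, by grind, by grind⟩ hab.symm hbc h
  have hax : G.Adj a x := ((hx a).2 (by simp)).symm
  have hbx : G.Adj b x := ((hx b).2 (by simp)).symm
  have hcx : G.Adj c x := ((hx c).2 (by simp)).symm
  have hdx : G.Adj d x := ((hx d).2 (by simp)).symm
  obtain ⟨a', han, ha', ha⟩ := 
    H.exists_hasNeighbors hax hab hda.symm (by grind) (by grind) (by grind)
  obtain ⟨b', hbn, hb', hb⟩ := 
    H.exists_hasNeighbors hbx hab.symm hbc (by grind) (by grind) (by grind)
  obtain ⟨c', hcn, hc', hc⟩ := 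
    H.exists_hasNeighbors hcx hbc.symm hcd (by grind) (by grind) (by grind)
  obtain ⟨d', hdn, hd', hd⟩ := 
    H.exists_hasNeighbors hdx hcd.symm hda (by grind) (by grind) (by grind)
  have hab' : a' ≠ b' := by
    rintro rfl
    exact H.not_three [x, a, b] a' c d (by simp) (by simp) (by grind)
  have had' : a' ≠ d' := by
    rintro rfl
    exact H.not_three [x, a, d] a' b c (by simp) (by simp) (by grind)
  have hbc' : b' ≠ c' := by
    rintro rfl
    exact H.not_three [x, b, c] b' a d (by simp) (by simp) (by grind)
  have hcd' : c' ≠ d' := by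
    rintro rfl
    exact H.not_three [x, c, d] c' a b (by simp) (by simp) (by grind)
  -- Of the six pairs in this boundary only `a'c'` can be an edge.
  have := H.twoEdges [x, a, c] a' b c' d (by simp) (by simp) (by grind [G.adj_comm]) (by grind)
  simp only [TwoEdges] at this
  grind [G.adj_comm]

/-- The boundary `a', b, c, d` of `{x, a}` needs an edge besides `bc`, which must be `a'd`. Likewise
`d` is adjacent to `b'` and `c'`, so `{x, a, b, c, d}` has boundary `a', b', c'`. -/
theorem not_triangle (H : G.WellLinked) {x a b c d : V} (hx : G.HasNeighbors x a b c d)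
    (hab : G.Adj a b) (hbc : G.Adj b c) (hac : G.Adj a c) : False := by
  have had : ¬ G.Adj a d := fun h => H.not_dominated hx hab hac h
  obtain ⟨hxd, hx', hx⟩ := hx
  have hbd : ¬ G.Adj b d := fun h => H.not_dominated (x := x) (a := b) (b := a) (c := c) (d := d)
    ⟨by grind, by grind, by grind⟩ hab.symm hbc h
  have hcd : ¬ G.Adj c d := fun h => H.not_dominated (x := x) (a := c) (b := a) (c := b) (d := d)
    ⟨by grind, by grind, by grind⟩ hac.symm hbc.symm h
  have hax : G.Adj a x := ((hx a).2 (by simp)).symm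
  have hbx : G.Adj b x := ((hx b).2 (by simp)).symm
  have hcx : G.Adj c x := ((hx c).2 (by simp)).symm
  have hdx : G.Adj d x := ((hx d).2 (by simp)).symm
  obtain ⟨a', ha'', ha', ha⟩ := H.exists_hasNeighbors hax hab hac (by grind) (by grind) (by grind)
  obtain ⟨b', hb'', hb', hb⟩ :=
    H.exists_hasNeighbors hbx hab.symm hbc (by grind) (by grind) (by grind)
  obtain ⟨c', hc'', hc', hc⟩ :=
    H.exists_hasNeighbors hcx hac.symm hbc.symm (by grind) (by grind) (by grind)
  have hab' : a' ≠ b' := by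
    rintro rfl
    exact H.not_three [x, a, b] a' c d (by simp) (by simp) (by grind)
  have hac' : a' ≠ c' := by
    rintro rfl
    exact H.not_three [x, a, c] a' b d (by simp) (by simp) (by grind)
  have hbc' : b' ≠ c' := by
    rintro rfl
    exact H.not_three [x, b, c] b' a d (by simp) (by simp) (by grind)
  have ea : G.Adj d a' := by
    have := H.twoEdges [x, a] a' b c d (by simp) (by simp) (by grind) (by grind)
    simp only [TwoEdges] at this
    grind [G.adj_comm]
  have eb : G.Adj d b' := by
    have := H.twoEdges [x, b] b' a c d (by simp) (by simp) (by grind) (by grind)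
    simp only [TwoEdges] at this
    grind [G.adj_comm]
  have ec : G.Adj d c' := by
    have := H.twoEdges [x, c] c' a b d (by simp) (by simp) (by grind) (by grind)
    simp only [TwoEdges] at this
    grind [G.adj_comm]
  obtain ⟨d', -, -, hd⟩ := H.exists_hasNeighbors ea eb ec (by grind) (by grind) (by grind)
  exact H.not_three [x, a, b, c, d] a' b' c' (by simp) (by simp) (by grind)

/-- The twisted alternative in `adj_of_path`. Growing a set around `x` excludes edges one by one,
until a four-vertex boundary with at most one edge appears. -/
theorem not_crossed (H : G.WellLinked) {x a b c d : V} (hx : G.HasNeighbors x a b c d)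
    (hab : G.Adj a b) (hcd : G.Adj c d) (hac : ¬ G.Adj a c)
    (hbd : ¬ G.Adj b d) (had : ¬ G.Adj a d) {b' c' : V} (hb : G.HasNeighbors b x a c b')
    (hc : G.HasNeighbors c x b d c') (hne : b' ≠ c') (hbd' : G.Adj b' d) (hca' : G.Adj c' a) :
    False := by
  obtain ⟨hx1, hx2, hx⟩ := hx
  obtain ⟨hb1, hb2, hb⟩ := hb
  obtain ⟨hc1, hc2, hc⟩ := hc
  have hax : G.Adj a x := ((hx a).2 (by simp)).symm
  have hdx : G.Adj d x := ((hx d).2 (by simp)).symm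
  have hbb' : G.Adj b' b := ((hb b').2 (by simp)).symm
  have hcc' : G.Adj c' c := ((hc c').2 (by simp)).symm
  have e1 : b' ≠ d := by grind
  have e2 : c' ≠ a := by grind [G.adj_comm]
  have e3 : b' ≠ x ∧ b' ≠ a ∧ b' ≠ c := by grind
  have e4 : c' ≠ x ∧ c' ≠ b ∧ c' ≠ d := by grind
  obtain ⟨a', ha1, ha2, ha⟩ :=
    H.exists_hasNeighbors hax hab hca'.symm (by grind) (by grind) (by grind)
  obtain ⟨d', hd1, hd2, hd⟩ :=
    H.exists_hasNeighbors hdx hcd.symm hbd'.symm (by grind) (by grind) (by grind)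
  have nad : a' ≠ d' := by
    rintro rfl
    exact H.not_three [x, a, b, c, d] a' b' c' (by simp) (by simp) (by grind)
  have nab' : ¬ G.Adj a b' := by
    intro h
    exact H.not_three [x, a, b, c] b' c' d (by simp) (by simp) (by grind)
  have ndc' : ¬ G.Adj d c' := by
    intro h
    exact H.not_three [x, d, b, c] b' c' a (by simp) (by simp) (by grind)
  have f1 : a' ≠ x ∧ a' ≠ b ∧ a' ≠ c ∧ a' ≠ d ∧ a' ≠ b' ∧ a' ≠ c' := by grind
  have f2 : d' ≠ x ∧ d' ≠ b ∧ d' ≠ c ∧ d' ≠ a ∧ d' ≠ b' ∧ d' ≠ c' := by grind [G.adj_comm]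
  have haa' : G.Adj a a' := (ha a').2 (by simp)
  have hdd' : G.Adj d d' := (hd d').2 (by simp)
  have nbc' : ¬ G.Adj b' c' := by
    intro h
    obtain ⟨z, hz1, hz2, hz⟩ := H.exists_hasNeighbors hbb' hbd' h (by grind) (by grind) (by grind)
    obtain ⟨w, hw1, hw2, hw⟩ :=
      H.exists_hasNeighbors hcc' hca' h.symm (by grind) (by grind) (by grind)
    have g1 : z ≠ a' := by
      rintro rfl
      exact H.not_three [x, a, b, c, d, b', c'] z d' w (by simp) (by simp) (by grind)
    have g2 : w ≠ a' := by
      rintro rfl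
      exact H.not_three [x, a, b, c, d, b', c'] w d' z (by simp) (by simp) (by grind)
    have g3 : z ≠ d' := by
      rintro rfl
      exact H.not_three [x, a, b, c, d, b', c'] z a' w (by simp) (by simp) (by grind)
    have g4 : w ≠ d' := by
      rintro rfl
      exact H.not_three [x, a, b, c, d, b', c'] w a' z (by simp) (by simp) (by grind)
    have hlz : G.Adj b' z := (hz z).2 (by simp)
    have g5 : z ≠ x ∧ z ≠ a ∧ z ≠ c := by grind [G.adj_comm]
    have hlw : G.Adj c' w := (hw w).2 (by simp)
    have g6 : w ≠ x ∧ w ≠ b ∧ w ≠ d := by grind [G.adj_comm]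
    have := H.twoEdges [x, b, c, b', c'] a d z w (by simp) (by simp) (by grind) (by grind)
    simp only [TwoEdges] at this
    grind
  have n1 : ¬ G.Adj b' a' := by
    intro h
    obtain ⟨z, hz1, hz2, hz⟩ := H.exists_hasNeighbors hbb' hbd' h (by grind) (by grind) (by grind)
    have g1 : z ≠ d' := by
      rintro rfl
      exact H.not_three [x, a, b, c, d, b'] a' z c' (by simp) (by simp) (by grind)
    have hlz : G.Adj b' z := (hz z).2 (by simp)
    have g5 : z ≠ x ∧ z ≠ a ∧ z ≠ c := by grind [G.adj_comm]
    have := H.twoEdges [b'] b d a' z (by simp) (by simp) (by grind) (by grind)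
    simp only [TwoEdges] at this
    grind
  have n2 : ¬ G.Adj c' d' := by
    intro h
    obtain ⟨z, hz1, hz2, hz⟩ := H.exists_hasNeighbors hcc' hca' h (by grind) (by grind) (by grind)
    have g1 : z ≠ a' := by
      rintro rfl
      exact H.not_three [x, a, b, c, d, c'] d' z b' (by simp) (by simp) (by grind)
    have hlz : G.Adj c' z := (hz z).2 (by simp)
    have g5 : z ≠ x ∧ z ≠ b ∧ z ≠ d := by grind [G.adj_comm]
    have := H.twoEdges [c'] c a d' z (by simp) (by simp) (by grind) (by grind)
    simp only [TwoEdges] at this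
    grind
  -- In this boundary `ac'` is an edge, and `b'd'` is the only other pair not yet excluded.
  have hbd'' : G.Adj b' d' := by
    have := H.twoEdges [x, b, c, d] d' a b' c' (by simp) (by simp) (by grind) (by grind)
    simp only [TwoEdges] at this
    grind [G.adj_comm]
  obtain ⟨z, hz1, hz2, hz⟩ :=
    H.exists_hasNeighbors hbb' hbd' hbd'' (by grind) (by grind) (by grind)
  have hlz : G.Adj b' z := (hz z).2 (by simp)
  have g5 : z ≠ x ∧ z ≠ a ∧ z ≠ c := by grind [G.adj_comm]
  have hzd : G.Adj d' z := by
    have := H.twoEdges [b'] b d d' z (by simp) (by simp) (by grind) (by grind)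
    simp only [TwoEdges] at this
    grind
  obtain ⟨y, hy1, hy2, hy⟩ :=
    H.exists_hasNeighbors hdd'.symm hbd''.symm hzd (by grind) (by grind) (by grind)
  have hly : G.Adj d' y := (hy y).2 (by simp)
  have g6 : y ≠ x ∧ y ≠ a ∧ y ≠ c := by grind [G.adj_comm]
  -- Only `zy` can be an edge here.
  have := H.twoEdges [b', d'] b d z y (by simp) (by simp) (by grind) (by grind)
  simp only [TwoEdges] at this
  grind

/-- If the neighborhood of `x` is a path `a b c d`, then the neighborhoods of the two middle
vertices are paths as well. -/
theorem adj_of_path (H : G.WellLinked) {x a b c d : V} (hx : G.HasNeighbors x a b c d)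
    (hab : G.Adj a b) (hcd : G.Adj c d) (hac : ¬ G.Adj a c)
    (hbd : ¬ G.Adj b d) (had : ¬ G.Adj a d) {b' c' : V} (hb : G.HasNeighbors b x a c b')
    (hc : G.HasNeighbors c x b d c') : G.Adj b' a ∧ G.Adj c' d := by
  obtain ⟨hxd, hx', hx⟩ := hx
  obtain ⟨hbd', hb', hb⟩ := hb
  obtain ⟨hcd', hc', hc⟩ := hc
  have hax : G.Adj a x := ((hx a).2 (by simp)).symm
  have hdx : G.Adj d x := ((hx d).2 (by simp)).symm
  have hne : b' ≠ c' := by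
    rintro rfl
    exact H.not_three [x, b, c] a b' d (by simp) (by simp) (by grind)
  -- The boundary of `{x, b}` contains the edge `cd` and needs a second one, which must use `b'`.
  have eb : G.Adj b' a ∨ G.Adj b' d := by
    have := H.twoEdges [x, b] a b' c d (by simp) (by simp) (by grind) (by grind)
    simp only [TwoEdges] at this
    grind [G.adj_comm]
  have ec : G.Adj c' a ∨ G.Adj c' d := by
    have := H.twoEdges [x, c] a b c' d (by simp) (by simp) (by grind) (by grind)
    simp only [TwoEdges] at this
    grind [G.adj_comm]
  have ncross : ¬ (G.Adj b' d ∧ G.Adj c' a) := by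
    rintro ⟨h1, h2⟩
    exact H.not_crossed ⟨hxd, hx', hx⟩ hab hcd hac hbd had ⟨hbd', hb', hb⟩ ⟨hcd', hc', hc⟩
      hne h1 h2
  have na : ¬ (G.Adj b' a ∧ G.Adj c' a) := by
    rintro ⟨h1, h2⟩
    obtain ⟨y, -, -, ha⟩ := H.exists_hasNeighbors hax hab h1.symm (by grind) (by grind) (by grind)
    exact H.not_three [x, a, b, c] b' c' d (by simp) (by simp) (by grind [G.adj_comm])
  have nd : ¬ (G.Adj b' d ∧ G.Adj c' d) := by
    rintro ⟨h1, h2⟩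
    obtain ⟨y, -, -, hd⟩ :=
      H.exists_hasNeighbors hdx hcd.symm h1.symm (by grind) (by grind) (by grind)
    exact H.not_three [x, d, b, c] b' c' a (by simp) (by simp) (by grind [G.adj_comm])
  tauto

/-- The boundary `a, b', c, d` of `{x, b}` needs two edges, all at `b'`. Adjacency of `b'` to both
`a` and `c` closes a 4-cycle around `b`; adjacency to just one makes the neighborhood of `b` a path
with middle vertex `x`, and `adj_of_path` gives `d` a neighbor among `a, c`. -/
theorem not_path_add_isolated (H : G.WellLinked) {x a b c d : V} (hx : G.HasNeighbors x a b c d)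
    (hab : G.Adj a b) (hbc : G.Adj b c) (hac : ¬ G.Adj a c)
    (had : ¬ G.Adj a d) (hbd : ¬ G.Adj b d) (hcd : ¬ G.Adj c d) : False := by
  obtain ⟨hx1, hx2, hx⟩ := hx
  have hax : G.Adj a x := ((hx a).2 (by simp)).symm
  have hbx : G.Adj b x := ((hx b).2 (by simp)).symm
  have hcx : G.Adj c x := ((hx c).2 (by simp)).symm
  obtain ⟨b', hb1, hb2, hb⟩ :=
    H.exists_hasNeighbors hbx hab.symm hbc (by grind) (by grind) (by grind)
  have nbx : ¬ G.Adj b' x := by grind [G.adj_comm]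
  have n1 : ¬ (G.Adj b' a ∧ G.Adj b' c) := by
    rintro ⟨h1, h2⟩
    exact H.not_fourCycle (x := b) (a := x) (b := a) (c := b') (d := c)
      ⟨by grind, by grind, by grind⟩ hax.symm h1.symm h2 hcx
  have n2 : ¬ G.Adj b' a := by
    intro h
    obtain ⟨a', ha⟩ := H.exists_hasNeighbors hab h.symm hax (by grind) (by grind) (by grind)
    exact hcd (H.adj_of_path (x := b) (a := b') (b := a) (c := x) (d := c)
      ⟨by grind, by grind, by grind⟩ h hcx.symm nbx hac (by tauto) ha
      ⟨by grind, by grind, by grind⟩).2.symm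
  have n3 : ¬ G.Adj b' c := by
    intro h
    obtain ⟨c', hc⟩ := H.exists_hasNeighbors hbc.symm h.symm hcx (by grind) (by grind) (by grind)
    exact had (H.adj_of_path (x := b) (a := b') (b := c) (c := x) (d := a)
      ⟨by grind, by grind, by grind⟩ h hax.symm nbx (fun h => hac h.symm) (by tauto) hc
      ⟨by grind, by grind, by grind⟩).2.symm
  have := H.twoEdges [x, b] a b' c d (by simp) (by simp) (by grind) (by grind)
  simp only [TwoEdges] at this
  grind [G.adj_comm]

end WellLinked

/-! ### Path neighborhoods -/

/-- The neighborhood of `x` induces the path `a b c d`. -/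
structure IsPathAt {V : Type*} (G : SimpleGraph V) (a b x c d : V) : Prop where
  nbrs : G.HasNeighbors x a b c d
  ab : G.Adj a b
  bc : G.Adj b c
  cd : G.Adj c d
  ac : ¬ G.Adj a c
  bd : ¬ G.Adj b d
  ad : ¬ G.Adj a d

theorem WellLinked.exists_isPathAt_next {V : Type*} {G : SimpleGraph V} (H : G.WellLinked)
    {a b x c d : V} (h : G.IsPathAt a b x c d) : ∃ e, G.IsPathAt b x c d e := by
  obtain ⟨hx, hab, hbc, hcd, hac, hbd, had⟩ := h
  have hx' := hx
  obtain ⟨hx1, hx2, hx3⟩ := hx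
  have hbx : G.Adj b x := ((hx3 b).2 (by simp)).symm
  have hcx : G.Adj c x := ((hx3 c).2 (by simp)).symm
  obtain ⟨b', hb⟩ := H.exists_hasNeighbors hbx hab.symm hbc (by grind) (by grind) (by grind)
  obtain ⟨e, hc⟩ := H.exists_hasNeighbors hcx hbc.symm hcd (by grind) (by grind) (by grind)
  obtain ⟨-, hde⟩ := H.adj_of_path hx' hab hcd hac hbd had hb hc
  obtain ⟨hb1, hb2, hb3⟩ := hb
  obtain ⟨hc1, hc2, hc3⟩ := hc
  have hne : b' ≠ e := by
    rintro rfl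
    exact H.not_three [x, b, c] a b' d (by simp) (by simp) (by grind)
  have hce : G.Adj c e := (hc3 e).2 (by simp)
  exact ⟨e, ⟨by grind, by grind, by grind⟩, hbx, (hx3 d).2 (by simp), hde.symm, hbd,
    by grind [G.adj_comm], by grind [G.adj_comm]⟩

theorem WellLinked.exists_isPathAt_of_cherry {V : Type*} {G : SimpleGraph V} (H : G.WellLinked)
    {x a b c d : V} (hx : G.HasNeighbors x a b c d) (hab : G.Adj a b) (hbc : G.Adj b c) :
    ∃ p q r s, G.IsPathAt p q x r s := by
  have hbd : ¬ G.Adj b d := fun h => H.not_dominated (x := x) (a := b) (b := a) (c := c) (d := d)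
    ⟨by grind [HasNeighbors], by grind [HasNeighbors], by grind [HasNeighbors]⟩ hab.symm hbc h
  have hac : ¬ G.Adj a c := fun h => H.not_triangle hx hab hbc h
  by_cases had : G.Adj a d
  · by_cases hcd : G.Adj c d
    · exact (H.not_fourCycle hx hab hbc hcd had.symm).elim
    · exact ⟨d, a, b, c, ⟨by grind [HasNeighbors], by grind [HasNeighbors],
        by grind [HasNeighbors]⟩, had.symm, hab, hbc, fun h => hbd h.symm, hac,
        fun h => hcd h.symm⟩
  · by_cases hcd : G.Adj c d
    · exact ⟨a, b, c, d, hx, hab, hbc, hcd, hac, hbd, had⟩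
    · exact (H.not_path_add_isolated hx hab hbc hac had hbd hcd).elim

theorem HasNeighbors.nonempty_iso_twoK2 {V : Type*} {G : SimpleGraph V} {x p q r s : V}
    (hx : G.HasNeighbors x p q r s) (hpq : G.Adj p q) (hrs : G.Adj r s) (hpr : ¬ G.Adj p r)
    (hps : ¬ G.Adj p s) (hqr : ¬ G.Adj q r) (hqs : ¬ G.Adj q s) :
    Nonempty (G.induce (G.neighborSet x) ≃g twoK2) := by
  obtain ⟨⟨h1, h2, h3, h4, h5, h6⟩, -, hx⟩ := hx
  have hp : p ∈ G.neighborSet x := (hx p).2 (by simp)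
  have hq : q ∈ G.neighborSet x := (hx q).2 (by simp)
  have hr : r ∈ G.neighborSet x := (hx r).2 (by simp)
  have hs : s ∈ G.neighborSet x := (hx s).2 (by simp)
  let φ : Fin 2 ⊕ Fin 2 → G.neighborSet x := Sum.elim ![⟨p, hp⟩, ⟨q, hq⟩] ![⟨r, hr⟩, ⟨s, hs⟩]
  have hφ : Function.Bijective φ := by
    constructor
    · rintro (i | i) (j | j) hij <;> fin_cases i <;> fin_cases j <;>
        simp_all [φ, Subtype.ext_iff, eq_comm]
    · rintro ⟨v, hv⟩
      rcases (hx v).1 hv with rfl | rfl | rfl | rfl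
      exacts [⟨Sum.inl 0, rfl⟩, ⟨Sum.inl 1, rfl⟩, ⟨Sum.inr 0, rfl⟩, ⟨Sum.inr 1, rfl⟩]
  refine ⟨RelIso.symm ⟨Equiv.ofBijective φ hφ, ?_⟩⟩
  rintro (i | i) (j | j) <;> fin_cases i <;> fin_cases j <;>
    simp [φ, twoK2, hpq, hrs, hpr, hps, hqr, hqs, hpq.symm, hrs.symm, G.adj_comm r, G.adj_comm s]

/-- Two edges on four vertices either meet, giving a cherry, or form a matching; without cherries
the matching is induced and the neighborhood is `2K₂`. -/
theorem WellLinked.exists_isPathAt {V : Type*} {G : SimpleGraph V} (H : G.WellLinked)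
    {x a b c d : V} (hx : G.HasNeighbors x a b c d)
    (hK : ¬ Nonempty (G.induce (G.neighborSet x) ≃g twoK2)) :
    ∃ p q r s, G.IsPathAt p q x r s := by
  by_contra hno
  have cherry : ∀ p q r s, G.HasNeighbors x p q r s → ¬ (G.Adj p q ∧ G.Adj q r) :=
    fun p q r s h h' => hno (H.exists_isPathAt_of_cherry h h'.1 h'.2)
  have iso : ∀ p q r s, G.HasNeighbors x p q r s → ¬ (G.Adj p q ∧ G.Adj r s ∧ ¬ G.Adj p r ∧
      ¬ G.Adj p s ∧ ¬ G.Adj q r ∧ ¬ G.Adj q s) :=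
    fun p q r s h ⟨h1, h2, h3, h4, h5, h6⟩ => hK (h.nonempty_iso_twoK2 h1 h2 h3 h4 h5 h6)
  have swap : ∀ p q r s, G.HasNeighbors x p q r s → G.HasNeighbors x q p r s :=
    fun p q r s ⟨_, _, _⟩ => ⟨by grind, by grind, by grind⟩
  have rot : ∀ p q r s, G.HasNeighbors x p q r s → G.HasNeighbors x q r s p :=
    fun p q r s ⟨_, _, _⟩ => ⟨by grind, by grind, by grind⟩
  have two : G.TwoEdges a b c d := by
    obtain ⟨_, _, _⟩ := hx
    exact H.twoEdges [x] a b c d (by simp) (by simp) (by grind) (by grind)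
  -- The twelve orderings obtained here put each of the twelve cherries once in the first three
  -- places.
  have x1 := rot _ _ _ _ hx
  have x2 := rot _ _ _ _ x1
  have x3 := rot _ _ _ _ x2
  have y0 := swap _ _ _ _ hx
  have y1 := rot _ _ _ _ y0
  have y2 := rot _ _ _ _ y1
  have y3 := rot _ _ _ _ y2
  have z0 := swap _ _ _ _ y1
  have z1 := rot _ _ _ _ z0
  have z2 := rot _ _ _ _ z1
  have z3 := rot _ _ _ _ z2
  have c0 := cherry _ _ _ _ hx
  have c1 := cherry _ _ _ _ x1
  have c2 := cherry _ _ _ _ x2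
  have c3 := cherry _ _ _ _ x3
  have c4 := cherry _ _ _ _ y0
  have c5 := cherry _ _ _ _ y1
  have c6 := cherry _ _ _ _ y2
  have c7 := cherry _ _ _ _ y3
  have c8 := cherry _ _ _ _ z0
  have c9 := cherry _ _ _ _ z1
  have c10 := cherry _ _ _ _ z2
  have c11 := cherry _ _ _ _ z3
  have i0 := iso _ _ _ _ hx
  have i1 := iso _ _ _ _ x1
  have i2 := iso _ _ _ _ y1
  have i3 := iso _ _ _ _ z0
  have i4 := iso _ _ _ _ z1
  clear cherry iso swap rot hno hK x1 x2 x3 y0 y1 y2 y3 z0 z1 z2 z3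
  unfold TwoEdges at two
  grind [G.adj_comm]

/-! ### Adjacency in the square of a cycle -/

theorem cycleGraph_adj_iff {m : ℕ} (hm : 2 ≤ m) (u v : Fin m) :
    (cycleGraph m).Adj u v ↔ u.val + 1 = v.val ∨ v.val + 1 = u.val ∨
      (u.val = 0 ∧ v.val + 1 = m) ∨ (v.val = 0 ∧ u.val + 1 = m) := by
  have hu := u.2
  have hv := v.2
  rw [cycleGraph_adj']
  rcases lt_trichotomy u v with h | h | h
  · rw [Fin.coe_sub_iff_lt.2 h, Fin.coe_sub_iff_le.2 h.le]
    have : u.val < v.val := h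
    omega
  · subst h
    rw [Fin.coe_sub_iff_le.2 le_rfl]
    omega
  · rw [Fin.coe_sub_iff_lt.2 h, Fin.coe_sub_iff_le.2 h.le]
    have : v.val < u.val := h
    omega

theorem cycleGraph_square_adj_iff {m : ℕ} (hm : 5 ≤ m) (u v : Fin m) :
    (cycleGraph m).square.Adj u v ↔
      u.val + 1 = v.val ∨ v.val + 1 = u.val ∨ u.val + 2 = v.val ∨ v.val + 2 = u.val ∨
      u.val + m = v.val + 1 ∨ v.val + m = u.val + 1 ∨
      u.val + m = v.val + 2 ∨ v.val + m = u.val + 2 := by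
  have hu := u.2
  have hv := v.2
  simp only [square, cycleGraph_adj_iff (show 2 ≤ m by omega), ne_eq, Fin.ext_iff]
  constructor
  · rintro ⟨h, h' | ⟨w, h1, h2⟩⟩
    · omega
    · have := w.2
      omega
  · intro h
    refine ⟨by omega, ?_⟩
    rcases h with h | h | h | h | h | h | h | h
    · left; omega
    · left; omega
    · exact Or.inr ⟨⟨u + 1, by omega⟩, by simp; omega⟩
    · exact Or.inr ⟨⟨v + 1, by omega⟩, by simp; omega⟩
    · left; omega
    · left; omega
    · by_cases h0 : u.val = 0
      · exact Or.inr ⟨⟨m - 1, by omega⟩, by simp; omega⟩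
      · exact Or.inr ⟨⟨0, by omega⟩, by simp; omega⟩
    · by_cases h0 : v.val = 0
      · exact Or.inr ⟨⟨m - 1, by omega⟩, by simp; omega⟩
      · exact Or.inr ⟨⟨0, by omega⟩, by simp; omega⟩

/-! ### From sliding windows to the square of a cycle -/

theorem WellLinked.exists_isPathAt_seq {V : Type*} {G : SimpleGraph V} (H : G.WellLinked)
    {a b x c d : V} (h : G.IsPathAt a b x c d) :
    ∃ f : ℕ → V, ∀ i, G.IsPathAt (f i) (f (i + 1)) (f (i + 2)) (f (i + 3)) (f (i + 4)) := by
  let T := {t : V × V × V × V × V // G.IsPathAt t.1 t.2.1 t.2.2.1 t.2.2.2.1 t.2.2.2.2}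
  have step : ∀ t : T, ∃ t' : T, t'.1.1 = t.1.2.1 ∧ t'.1.2.1 = t.1.2.2.1 ∧
      t'.1.2.2.1 = t.1.2.2.2.1 ∧ t'.1.2.2.2.1 = t.1.2.2.2.2 := by
    rintro ⟨⟨p, q, y, r, s⟩, ht⟩
    obtain ⟨e, he⟩ := H.exists_isPathAt_next ht
    exact ⟨⟨⟨q, y, r, s, e⟩, he⟩, rfl, rfl, rfl, rfl⟩
  choose g h1 h2 h3 h4 using step
  let F : ℕ → T := fun i => g^[i] ⟨⟨a, b, x, c, d⟩, h⟩
  have hF : ∀ i, F (i + 1) = g (F i) := fun i => Function.iterate_succ_apply' g i _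
  refine ⟨fun i => (F i).1.1, fun i => ?_⟩
  have e1 : ∀ i, (F (i + 1)).1.1 = (F i).1.2.1 := fun i => by rw [hF, h1]
  have e2 : ∀ i, (F (i + 2)).1.1 = (F i).1.2.2.1 := fun i => by rw [e1, hF, h2]
  have e3 : ∀ i, (F (i + 3)).1.1 = (F i).1.2.2.2.1 := fun i => by rw [e2, hF, h3]
  have e4 : ∀ i, (F (i + 4)).1.1 = (F i).1.2.2.2.2 := fun i => by rw [e3, hF, h4]
  have h := (F i).2
  rw [← e1, ← e2, ← e3, ← e4] at h
  exact h

/-- A sequence in a finite graph all of whose windows are path neighborhoods closes up. -/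
theorem WellLinked.exists_period {V : Type*} [Finite V] {G : SimpleGraph V} (H : G.WellLinked)
    {f : ℕ → V}
    (hf : ∀ i, G.IsPathAt (f i) (f (i + 1)) (f (i + 2)) (f (i + 3)) (f (i + 4))) :
    ∃ m, 5 ≤ m ∧ (∀ i, f (i + m) = f i) ∧ ∀ i j, i < m → j < m → f i = f j → i = j := by
  classical
  have hN : ∀ i w, G.Adj (f (i + 2)) w ↔
      w = f i ∨ w = f (i + 1) ∨ w = f (i + 3) ∨ w = f (i + 4) := fun i => (hf i).nbrs.2.2
  have a1 : ∀ i, G.Adj (f i) (f (i + 1)) := fun i => (hf i).ab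
  have a2 : ∀ i, G.Adj (f i) (f (i + 2)) := fun i => ((hN i (f i)).2 (by simp)).symm
  have d1 : ∀ i, f i ≠ f (i + 1) := fun i => (a1 i).ne
  have d2 : ∀ i, f i ≠ f (i + 2) := fun i => (a2 i).ne
  have d3 : ∀ i, f i ≠ f (i + 3) := fun i => (hf i).nbrs.1.2.1
  have d4 : ∀ i, f i ≠ f (i + 4) := fun i => (hf i).nbrs.1.2.2.1
  -- The ends of a window are nonadjacent, whereas `f (i + 4)` and `f (i + 5)` are adjacent.
  have d5 : ∀ i, f i ≠ f (i + 5) := by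
    intro i h
    have := a1 (i + 4)
    rw [show i + 4 + 1 = i + 5 from rfl, ← h] at this
    exact (hf i).ad this.symm
  have hex : ∃ m, ∃ k, k < m ∧ f k = f m := by
    obtain ⟨i, j, hij, h⟩ := Finite.exists_ne_map_eq_of_infinite f
    rcases lt_or_gt_of_ne hij with h' | h'
    exacts [⟨j, i, h', h⟩, ⟨i, j, h', h.symm⟩]
  have hinj : ∀ i j, i < Nat.find hex → j < Nat.find hex → f i = f j → i = j := by
    intro i j hi hj h
    rcases lt_trichotomy i j with h' | h' | h'
    · exact (Nat.find_min hex hj ⟨i, h', h⟩).elim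
    · exact h'
    · exact (Nat.find_min hex hi ⟨j, h', h.symm⟩).elim
  obtain ⟨k, hk, hkm⟩ := Nat.find_spec hex
  generalize Nat.find hex = m at *
  have hm : k + 6 ≤ m := by
    by_contra hlt
    obtain h | h | h | h | h : m = k + 1 ∨ m = k + 2 ∨ m = k + 3 ∨ m = k + 4 ∨ m = k + 5 := by
      omega
    all_goals subst h
    exacts [d1 k hkm, d2 k hkm, d3 k hkm, d4 k hkm, d5 k hkm]
  obtain ⟨n, rfl⟩ : ∃ n, m = n + 2 := ⟨m - 2, by omega⟩
  -- At the first repetition `f k = f m`, the term `f (m - 1)` is a further neighbor of `f k`. For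
  -- `k ≥ 2` the four neighbors are already known; for `k = 1` only three are, but `f (m - 2)` and
  -- `f (m - 1)` compete for the fourth place.
  have hk0 : k = 0 := by
    rcases k with _ | _ | k
    · rfl
    · exfalso
      obtain ⟨s, -, -, -, hs⟩ := H.fourth (a1 0).symm (a1 1) (a2 1) (d2 0) (d3 0) (d1 2)
      have e1 : f n = s := by
        have h := (a2 n).symm
        rw [← hkm] at h
        rcases (hs _).1 h with h | h | h | h
        · have := hinj _ _ (by omega) (by omega) h; omega
        · have := hinj _ _ (by omega) (by omega) h; omega
        · have := hinj _ _ (by omega) (by omega) h; omega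
        · exact h
      have e2 : f (n + 1) = s := by
        have h := (a1 (n + 1)).symm
        rw [show n + 1 + 1 = n + 2 from rfl, ← hkm] at h
        rcases (hs _).1 h with h | h | h | h
        · have := hinj _ _ (by omega) (by omega) h; omega
        · have := hinj _ _ (by omega) (by omega) h; omega
        · have := hinj _ _ (by omega) (by omega) h; omega
        · exact h
      exact d1 n (e1.trans e2.symm)
    · exfalso
      have h := (a1 (n + 1)).symm
      rw [show n + 1 + 1 = n + 2 from rfl, ← hkm] at h
      rcases (hN k _).1 h with h | h | h | h <;>
        · have := hinj _ _ (by omega) (by omega) h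
          omega
  subst hk0
  have m1 : f 1 = f (n + 3) ∨ f 1 = f (n + 4) := by
    have h := a1 0
    rw [hkm] at h
    rcases (hN n _).1 h with h | h | h
    · have := hinj _ _ (by omega) (by omega) h; omega
    · have := hinj _ _ (by omega) (by omega) h; omega
    · exact h
  have m2 : f 2 = f (n + 3) ∨ f 2 = f (n + 4) := by
    have h := a2 0
    rw [hkm] at h
    rcases (hN n _).1 h with h | h | h
    · have := hinj _ _ (by omega) (by omega) h; omega
    · have := hinj _ _ (by omega) (by omega) h; omega
    · exact h
  have n2 : f 2 ≠ f (n + 3) := by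
    intro h
    have h' := (a2 (n + 1)).symm
    rw [show n + 1 + 2 = n + 3 from rfl, ← h] at h'
    rcases (hN 0 _).1 h' with h | h | h | h <;>
      · have := hinj _ _ (by omega) (by omega) h
        omega
  have e2 : f 2 = f (n + 4) := m2.resolve_left n2
  have e1 : f 1 = f (n + 3) := m1.resolve_right fun h => d1 1 (h.trans e2.symm)
  have e3 : f 3 = f (n + 5) := by
    have h := a2 1
    rw [e1] at h
    rcases (hN (n + 1) _).1 h with h | h | h | h
    · have := hinj _ _ (by omega) (by omega) h; omega
    · exact (d3 0 (hkm.trans h.symm)).elim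
    · exact (d1 2 (e2.trans h.symm)).elim
    · exact h
  -- Four consecutive agreements propagate: the next term is the one neighbor of the third that is
  -- not among the other known terms.
  have hall : ∀ i, f (i + (n + 2)) = f i ∧ f (i + 1 + (n + 2)) = f (i + 1) ∧
      f (i + 2 + (n + 2)) = f (i + 2) ∧ f (i + 3 + (n + 2)) = f (i + 3) := by
    intro i
    induction i with
    | zero =>
      refine ⟨?_, ?_, ?_, ?_⟩
      · rw [hkm]; congr 1; omega
      · rw [e1]; congr 1; omega
      · rw [e2]; congr 1; omega
      · rw [e3]; congr 1; omega
    | succ i ih =>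
      obtain ⟨h0, h1, h2, h3⟩ := ih
      refine ⟨h1, h2, h3, ?_⟩
      have h := a2 (i + 2)
      rw [← h2, show i + 2 + (n + 2) = (i + (n + 2)) + 2 by ring, hN,
        show i + (n + 2) + 1 = i + 1 + (n + 2) by ring,
        show i + (n + 2) + 3 = i + 3 + (n + 2) by ring, h0, h1, h3] at h
      rcases h with h | h | h | h
      · exact (d4 i h.symm).elim
      · exact (d3 (i + 1) h.symm).elim
      · exact (d1 (i + 3) h.symm).elim
      · rw [show i + 1 + 3 = i + 2 + 2 by ring, h]; congr 1; ring
  exact ⟨n + 2, by omega, fun i => (hall i).1, hinj⟩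

theorem WellLinked.nonempty_iso_square {V : Type*} [Fintype V] {G : SimpleGraph V}
    (H : G.WellLinked) (hG : G.Connected) {a b x c d : V} (h : G.IsPathAt a b x c d) :
    Nonempty (G ≃g (cycleGraph (Fintype.card V)).square) := by
  obtain ⟨f, hf⟩ := H.exists_isPathAt_seq h
  obtain ⟨m, hm, hper, hinj⟩ := H.exists_period hf
  have hmod : ∀ i, f i = f (i % m) := by
    intro i
    induction i using Nat.strong_induction_on with
    | _ i ih =>
      by_cases hi : i < m
      · rw [Nat.mod_eq_of_lt hi]
      · obtain ⟨j, rfl⟩ := Nat.exists_eq_add_of_le' (not_lt.1 hi)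
        rw [hper, ih j (by omega), Nat.add_mod_right]
  -- Adding the period `m` keeps the indices `i - 2` and `i - 1` natural.
  have hN : ∀ i w, G.Adj (f i) w ↔
      w = f (i + m - 2) ∨ w = f (i + m - 1) ∨ w = f (i + m + 1) ∨ w = f (i + m + 2) := by
    intro i w
    have := (hf (i + m - 2)).nbrs.2.2 w
    rw [show i + m - 2 + 2 = i + m by omega, show i + m - 2 + 1 = i + m - 1 by omega,
      show i + m - 2 + 3 = i + m + 1 by omega, show i + m - 2 + 4 = i + m + 2 by omega,
      hper] at this
    exact this
  let φ : Fin m → V := fun i => f i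
  have hφ : Function.Bijective φ := by
    refine ⟨fun i j hij => Fin.ext (hinj _ _ i.2 j.2 hij), fun v => ?_⟩
    -- The range of `f` is closed under adjacency, so connectivity makes it everything.
    have key : ∀ u w : V, G.Walk u w → (∃ i, f i = u) → ∃ i, f i = w := by
      intro u w p
      induction p with
      | nil => exact id
      | cons hadj _ ih =>
        rintro ⟨i, rfl⟩
        refine ih ?_
        rcases (hN i _).1 hadj with h | h | h | h <;> exact ⟨_, h.symm⟩
    obtain ⟨p⟩ := hG.preconnected (f 0) v
    obtain ⟨i, rfl⟩ := key _ _ p ⟨0, rfl⟩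
    exact ⟨⟨i % m, Nat.mod_lt _ (by omega)⟩, (hmod i).symm⟩
  have hcard : Fintype.card V = m := by
    rw [← Fintype.card_of_bijective hφ, Fintype.card_fin]
  rw [hcard]
  have hval : ∀ (v : Fin m) (j : ℕ), j < 3 * m →
      (f v = f j ↔ j = v ∨ j = v + m ∨ j = v + 2 * m) := by
    intro v j hj
    have hv := v.2
    constructor
    · intro h
      rcases lt_or_ge j m with h1 | h1
      · exact Or.inl (hinj _ _ h1 hv h.symm)
      obtain ⟨j, rfl⟩ := Nat.exists_eq_add_of_le' h1
      rw [hper] at h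
      rcases lt_or_ge j m with h1 | h1
      · have := hinj _ _ h1 hv h.symm
        omega
      obtain ⟨j, rfl⟩ := Nat.exists_eq_add_of_le' h1
      rw [hper] at h
      have := hinj _ _ (by omega) hv h.symm
      omega
    · rintro (rfl | rfl | rfl)
      · rfl
      · rw [hper]
      · rw [two_mul, ← add_assoc, hper, hper]
  refine ⟨RelIso.symm ⟨Equiv.ofBijective φ hφ, ?_⟩⟩
  intro u v
  have hu := u.2
  have hv := v.2
  rw [cycleGraph_square_adj_iff hm]
  change G.Adj (f u) (f v) ↔ _
  rw [hN, hval v _ (by omega), hval v _ (by omega), hval v _ (by omega), hval v _ (by omega)]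
  omega

end SimpleGraph

theorem theorem3 :
    ∃ N : ℕ, ∀ (V : Type*) [Fintype V] (G : SimpleGraph V) [DecidableRel G.Adj],
      N ≤ Fintype.card V →
      G.Connected →
      G.IsRegularOfDegree 4 →
      (∃ x : V, ¬ Nonempty (G.induce (G.neighborSet x) ≃g SimpleGraph.twoK2)) →
      (Nonempty (G ≃g (SimpleGraph.cycleGraph (Fintype.card V)).square) ∨
        ∃ S : Finset V, G.IsMinimalCutset S ∧ S.card ≤ 4 ∧ G.avgDegreeOn S < 1) := by
  refine ⟨20, fun V _ G _ hcard hG hreg ⟨x, hx⟩ => ?_⟩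
  classical
  by_cases hS : ∃ S : Finset V, G.IsMinimalCutset S ∧ S.card ≤ 4 ∧ G.avgDegreeOn S < 1
  · exact Or.inr hS
  refine Or.inl ?_
  have H := SimpleGraph.wellLinked hcard hreg hG fun S h1 h2 h3 => hS ⟨S, h1, h2, h3⟩
  obtain ⟨p, q, r, _, hpq, hpr, hqr, -, -, -, hN⟩ := hreg.exists_neighbors x
  obtain ⟨s, hs⟩ := H.exists_hasNeighbors ((hN p).2 (by simp)) ((hN q).2 (by simp))
    ((hN r).2 (by simp)) hpq hpr hqr
  obtain ⟨a, b, c, d, h⟩ := H.exists_isPathAt hs hx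
  exact H.nonempty_iso_square hG h
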